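/- Terms of strictly linear (resp. strictly affine) combinatory logic are built by application from variables, constants and the combinators $B,C,I$ (resp. $B,C,I,K$). The strictly linear (resp. affine) $\lambda$-calculus consists of the $\lambda$-terms in which every abstraction $\lambda x.M$ binds a variable that occurs free in $M$ exactly once (resp. at most once); its provable equality is the congruence generated by the $\beta$-rule and by the $\xi$-rule, both restricted to such abstractions. For a combinatory term $M$ let $(M)_\lambda$ be the $\lambda$-term obtained by replacing $B,C,I,K$ with $\lambda xyz.x(yz)$, $\lambda xyz.(xz)y$, $\lambda x.x$, $\lambda xy.x$. A strictly linear (resp. affine) combinatory algebra is a set $A$ with a binary application and distinguished elements $B,C,I$ (resp. $B,C,I,K$) such that $Bxyz=x(yz)$, $Cxyz=(xz)y$, $Ix=x$ (resp. also $Kxy=x$) for all $x,y,z\in A$. It is a strictly linear (resp. affine) $\lambda$-algebra if, for all closed combinatory terms $M,N$ with constants $c_a$ $(a\in A)$, provable equality of $(M)_\lambda$ and $(N)_\lambda$ in the strictly linear (resp. affine) $\lambda$-calculus implies $[\![M]\!]_A=[\![N]\!]_A$. It is a strictly linear (resp. affine) combinatory $\lambda$-model if there is $\epsilon\in A$ such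 that for all $x,y\in A$: $\epsilon xy=xy$, and $(\forall z\in A,\ xz=yz)\Rightarrow \epsilon x=\epsilon y$. Let $T_\Sigma$ be the set of terms over a constant $e$, unary symbols $l,r$ and a binary symbol $\langle\ ,\ \rangle$, and let $\mathcal P$ be the set of partial involutions on $T_\Sigma$, i.e. of partial injective functions $f$ with $f(u)=v\Leftrightarrow f(v)=u$. For $f,g\in\mathcal P$ put $f\cdot g=f_{rr}\cup(f_{rl};g;(f_{ll};g)^*;f_{lr})$, where $f_{ij}=\{(u,v)\mid (i(u),j(v))\in f\}$ and $;$ is composition from left to right. Let $B,C,I\in\mathcal P$ be given, with $x$ ranging over $T_\Sigma$, by $$B:\ r^3x\leftrightarrow lrx,\ l^2x\leftrightarrow rlrx,\ rl^2x\leftrightarrow r^2lx;\qquad C:\ l^2x\leftrightarrow r^2lx,\ lrlx\leftrightarrow rlx,\ lr^2x\leftrightarrow r^3x;\qquad I:\ lx\leftrightarrow rx.$$ Proposition. (i) $(\mathcal P,\cdot)$ with $B,C,I$ is a strictly linear $\lambda$-algebra that is not a strictly linear combinatory $\lambda$-model; so not all strictly linear $\lambda$-algebras are strictly linear combinatory $\lambda$-models.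 (ii) Not all strictly affine $\lambda$-algebras are strictly affine combinatory $\lambda$-models. -/

import Mathlib

namespace StrictLambda

universe u

/-- The two disciplines: strictly linear and strictly affine. -/
inductive Mode : Type
  | linear
  | affine

/-- An abstracted variable occurs exactly once (linear mode), at most once (affine mode). -/
def Mode.Admits : Mode → ℕ → Prop
  | .linear, n => n = 1
  | .affine, n => n ≤ 1

/-- The distinguished combinators: `B, C, I`, and `K` in the affine mode only. -/
inductive Comb : Mode → Type
  | B {m : Mode} : Comb m
  | C {m : Mode} : Comb m
  | I {m : Mode} : Comb m
  | K : Comb Mode.affine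

/-- Terms of strictly linear (affine) combinatory logic, with variables `0, 1, 2, …` and
constants in `κ` besides the distinguished combinators. -/
inductive CLTerm (m : Mode) (κ : Type u) : Type u
  | var (n : ℕ) : CLTerm m κ
  | const (c : κ) : CLTerm m κ
  | comb (c : Comb m) : CLTerm m κ
  | app (M N : CLTerm m κ) : CLTerm m κ

/-- A term of combinatory logic is closed if no variable occurs in it. -/
def CLTerm.Closed {m : Mode} {κ : Type u} : CLTerm m κ → Prop
  | .var _ => False
  | .const _ => True
  | .comb _ => True
  | .app M N => M.Closed ∧ N.Closed

/-- Raw `λ`-terms with constants in `κ`, up to `α`-equivalence (de Bruijn indices). -/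
inductive LTerm (κ : Type u) : Type u
  | var (n : ℕ) : LTerm κ
  | const (c : κ) : LTerm κ
  | app (M N : LTerm κ) : LTerm κ
  | lam (M : LTerm κ) : LTerm κ

namespace LTerm

variable {κ : Type u}

/-- The number of free occurrences of the variable with index `k`. -/
def occ : ℕ → LTerm κ → ℕ
  | k, .var n => if n = k then 1 else 0
  | _, .const _ => 0
  | k, .app M N => occ k M + occ k N
  | k, .lam M => occ (k + 1) M

/-- Extension of a renaming under a binder. -/
def upRen (ξ : ℕ → ℕ) : ℕ → ℕ
  | 0 => 0
  | n + 1 => ξ n + 1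

def rename : (ℕ → ℕ) → LTerm κ → LTerm κ
  | ξ, .var n => .var (ξ n)
  | _, .const c => .const c
  | ξ, .app M N => .app (rename ξ M) (rename ξ N)
  | ξ, .lam M => .lam (rename (upRen ξ) M)

/-- Extension of a substitution under a binder. -/
def up (σ : ℕ → LTerm κ) : ℕ → LTerm κ
  | 0 => .var 0
  | n + 1 => rename Nat.succ (σ n)

/-- Simultaneous capture-avoiding substitution. -/
def subst : (ℕ → LTerm κ) → LTerm κ → LTerm κ
  | σ, .var n => σ n
  | _, .const c => .const c
  | σ, .app M N => .app (subst σ M) (subst σ N)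
  | σ, .lam M => .lam (subst (up σ) M)

/-- The substitution of `N` for the variable `0`, which lowers the other indices by one. -/
def single (N : LTerm κ) : ℕ → LTerm κ
  | 0 => N
  | n + 1 => .var n

/-- `M[N/x]`, where `x` is the variable bound by the abstraction of `M`. -/
def inst (M N : LTerm κ) : LTerm κ := subst (single N) M

/-- The terms of the strictly linear (affine) `λ`-calculus: every abstraction binds a variable
that occurs exactly once (at most once) in its body. -/
def WF (m : Mode) : LTerm κ → Prop
  | .var _ => True
  | .const _ => True
  | .app M N => WF m M ∧ WF m N
  | .lam M => WF m M ∧ m.Admits (occ 0 M)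

/-- Provable equality of the strictly linear (affine) `λ`-calculus: the congruence on its terms
given by the restricted `β`- and `ξ`-rules. -/
inductive Eqv (m : Mode) : LTerm κ → LTerm κ → Prop
  | refl {M : LTerm κ} : WF m M → Eqv m M M
  | symm {M N : LTerm κ} : Eqv m M N → Eqv m N M
  | trans {M N P : LTerm κ} : Eqv m M N → Eqv m N P → Eqv m M P
  | app {M M' N N' : LTerm κ} : Eqv m M M' → Eqv m N N' → Eqv m (.app M N) (.app M' N')
  | beta {M N : LTerm κ} : WF m (.lam M) → WF m N → Eqv m (.app (.lam M) N) (inst M N)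
  | xi {M N : LTerm κ} : Eqv m M N → m.Admits (occ 0 M) → m.Admits (occ 0 N) →
      Eqv m (.lam M) (.lam N)

end LTerm

/-- The `λ`-term of a combinator: `B = λxyz.x(yz)`, `C = λxyz.(xz)y`, `I = λx.x`, `K = λxy.x`. -/
def Comb.toLam {m : Mode} {κ : Type u} : Comb m → LTerm κ
  | .B => .lam (.lam (.lam (.app (.var 2) (.app (.var 1) (.var 0)))))
  | .C => .lam (.lam (.lam (.app (.app (.var 2) (.var 0)) (.var 1))))
  | .I => .lam (.var 0)
  | .K => .lam (.lam (.var 1))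

/-- The translation `M ↦ (M)_λ`, which replaces each combinator by its `λ`-term. -/
def CLTerm.toLam {m : Mode} {κ : Type u} : CLTerm m κ → LTerm κ
  | .var n => .var n
  | .const c => .const c
  | .comb c => c.toLam
  | .app M N => .app M.toLam N.toLam

/-- An applicative structure with distinguished elements for the combinators. -/
structure CombStr (m : Mode) (A : Type u) where
  app : A → A → A
  comb : Comb m → A

namespace CombStr

variable {m : Mode} {A : Type u}

/-- The equation that the element `a` has to satisfy in order to interpret a combinator. -/
def Law (S : CombStr m A) (a : A) : Comb m → Prop
  | .B => ∀ x y z, S.app (S.app (S.app a x) y) z = S.app x (S.app y z)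
  | .C => ∀ x y z, S.app (S.app (S.app a x) y) z = S.app (S.app x z) y
  | .I => ∀ x, S.app a x = x
  | .K => ∀ x y, S.app (S.app a x) y = x

/-- Strictly linear (affine) combinatory algebras. -/
def IsCombAlgebra (S : CombStr m A) : Prop :=
  ∀ c : Comb m, S.Law (S.comb c) c

/-- Interpretation of the terms with constants `c_a`, `a ∈ A`; on closed terms it does not depend
on the valuation `ρ`. -/
def eval (S : CombStr m A) (ρ : ℕ → A) : CLTerm m A → A
  | .var n => ρ n
  | .const a => a
  | .comb c => S.comb c
  | .app M N => S.app (eval S ρ M) (eval S ρ N)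

/-- Strictly linear (affine) `λ`-algebras. -/
def IsLambdaAlgebra (S : CombStr m A) : Prop :=
  S.IsCombAlgebra ∧
    ∀ M N : CLTerm m A, M.Closed → N.Closed → LTerm.Eqv m M.toLam N.toLam →
      ∀ ρ : ℕ → A, S.eval ρ M = S.eval ρ N

/-- Strictly linear (affine) combinatory `λ`-models. -/
def IsCombinatoryModel (S : CombStr m A) : Prop :=
  S.IsCombAlgebra ∧
    ∃ ε : A, (∀ x y, S.app (S.app ε x) y = S.app x y) ∧
      ∀ x y, (∀ z, S.app x z = S.app y z) → S.app ε x = S.app ε y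

end CombStr

/-- The moves: the terms over one constant `e`, unary `l`, `r` and a binary pairing. -/
inductive Move : Type
  | e : Move
  | l (t : Move) : Move
  | r (t : Move) : Move
  | pair (t u : Move) : Move

/-- Partial involutions over the moves, given by their graphs. Injectivity follows from
functionality and symmetry. -/
@[ext]
structure PInv : Type where
  rel : Move → Move → Prop
  functional : ∀ u v w, rel u v → rel u w → v = w
  symm : ∀ u v, rel u v → rel v u

namespace PInv

open Relation

/-- `sub f i j` is `f_{ij} = {(u, v) | (i(u), j(v)) ∈ f}`. -/
def sub (f : PInv) (i j : Move → Move) (u v : Move) : Prop := f.rel (i u) (j v)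

/-- The graph `f_rr ∪ (f_rl ; g ; (f_ll ; g)^* ; f_lr)` of the linear application `f · g`. -/
def appRel (f g : PInv) (u v : Move) : Prop :=
  f.sub .r .r u v ∨
    Comp (Comp (Comp (f.sub .r .l) g.rel) (ReflTransGen (Comp (f.sub .l .l) g.rel)))
      (f.sub .l .r) u v

theorem loop_symm (f g : PInv) {a b c : Move} (h : g.rel a b)
    (hs : ReflTransGen (Comp (f.sub .l .l) g.rel) b c) :
    ∃ d, g.rel c d ∧ ReflTransGen (Comp (f.sub .l .l) g.rel) d a := by
  induction hs with
  | refl => exact ⟨a, g.symm _ _ h, .refl⟩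
  | tail _ hbc ih =>
    obtain ⟨x, hx, hxc⟩ := hbc
    obtain ⟨d, hd, hda⟩ := ih
    exact ⟨x, g.symm _ _ hxc, .head ⟨_, f.symm _ _ hx, hd⟩ hda⟩

theorem appRel_symm (f g : PInv) (u v : Move) (h : f.appRel g u v) : f.appRel g v u := by
  rcases h with h | ⟨c, ⟨b, ⟨a, hua, hab⟩, hbc⟩, hcv⟩
  · exact Or.inl (f.symm _ _ h)
  · obtain ⟨d, hd, hda⟩ := loop_symm f g hab hbc
    exact Or.inr ⟨a, ⟨d, ⟨c, f.symm _ _ hcv, hd⟩, hda⟩, f.symm _ _ hua⟩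

theorem exit_unique (f g : PInv) {c c' v v' : Move}
    (h : ReflTransGen (Comp (f.sub .l .l) g.rel) c c')
    (hv : f.sub .l .r c v) (hv' : f.sub .l .r c' v') : v = v' := by
  rcases h.cases_head with rfl | ⟨_, ⟨x, hx, _⟩, _⟩
  · exact Move.r.inj (f.functional _ _ _ hv hv')
  · exact absurd (f.functional _ _ _ hv hx) (by simp)

theorem appRel_functional (f g : PInv) (u v w : Move) (h : f.appRel g u v)
    (h' : f.appRel g u w) : v = w := by
  rcases h with h | ⟨c, ⟨b, ⟨a, hua, hab⟩, hbc⟩, hcv⟩ <;>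
    rcases h' with h' | ⟨c', ⟨b', ⟨a', hua', hab'⟩, hbc'⟩, hcv'⟩
  · exact Move.r.inj (f.functional _ _ _ h h')
  · exact absurd (f.functional _ _ _ h hua') (by simp)
  · exact absurd (f.functional _ _ _ h' hua) (by simp)
  · obtain rfl := Move.l.inj (f.functional _ _ _ hua hua')
    obtain rfl := g.functional _ _ _ hab hab'
    have hu : Relator.RightUnique (Comp (f.sub .l .l) g.rel) := by
      rintro x y z ⟨p, hp, hpy⟩ ⟨q, hq, hqz⟩
      obtain rfl := Move.l.inj (f.functional _ _ _ hp hq)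
      exact g.functional _ _ _ hpy hqz
    rcases ReflTransGen.total_of_right_unique hu hbc hbc' with k | k
    · exact exit_unique f g k hcv hcv'
    · exact (exit_unique f g k hcv' hcv).symm

/-- Linear application. -/
def app (f g : PInv) : PInv where
  rel := f.appRel g
  functional := f.appRel_functional g
  symm := f.appRel_symm g

/-- `r³x ↔ lrx`, `l²x ↔ rlrx`, `rl²x ↔ r²lx`, read from left to right. -/
inductive BRule : Move → Move → Prop
  | one (x : Move) : BRule (.r (.r (.r x))) (.l (.r x))
  | two (x : Move) : BRule (.l (.l x)) (.r (.l (.r x)))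
  | three (x : Move) : BRule (.r (.l (.l x))) (.r (.r (.l x)))

/-- `l²x ↔ r²lx`, `lrlx ↔ rlx`, `lr²x ↔ r³x`, read from left to right. -/
inductive CRule : Move → Move → Prop
  | one (x : Move) : CRule (.l (.l x)) (.r (.r (.l x)))
  | two (x : Move) : CRule (.l (.r (.l x))) (.r (.l x))
  | three (x : Move) : CRule (.l (.r (.r x))) (.r (.r (.r x)))

/-- `lx ↔ rx`, read from left to right. -/
inductive IRule : Move → Move → Prop
  | one (x : Move) : IRule (.l x) (.r x)

def B : PInv where
  rel u v := BRule u v ∨ BRule v u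
  functional := by
    rintro u v w (h | h) (h' | h') <;> cases h <;> cases h' <;> rfl
  symm _ _ := Or.symm

def C : PInv where
  rel u v := CRule u v ∨ CRule v u
  functional := by
    rintro u v w (h | h) (h' | h') <;> cases h <;> cases h' <;> rfl
  symm _ _ := Or.symm

def I : PInv where
  rel u v := IRule u v ∨ IRule v u
  functional := by
    rintro u v w (h | h) (h' | h') <;> cases h <;> cases h' <;> rfl
  symm _ _ := Or.symm

/-- The strictly linear combinatory algebra of partial involutions. -/
def alg : CombStr Mode.linear PInv where
  app := app
  comb
    | .B => B
    | .C => C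
    | .I => I

end PInv

end StrictLambda

/-!
Call a combinatory `λ`-model *stable* if its element `ε` fixes each combinator and its partial
applications. Such a model interprets `λ`-terms by bracket abstraction followed by `ε`, this
interpretation respects provable equality, and it sends `(M)_λ` to the value of `M`. Hence every
algebra that embeds in a stable model, such as a graph model, is a `λ`-algebra.

A partial involution `f` is sent to the set of the finite sets of moves that `f` preserves, an arrow
`a ⊸ b` being the disjoint union `l a ∪ r b`. That application is respected amounts to this: a run
through finite sets preserved by `f` and `g` must leave them, because each of its steps is
injective. If some `ε` made the partial involutions a combinatory `λ`-model, then `ε` would have to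
relate `l (l e)` to `r (l e)`, and so would separate the exchange of `l e` with itself from the
empty involution. But these two act alike, as neither is defined on any move `r u`.

In the affine case the elements are sets of tokens graded by multisets of indeterminates. With
finitely many indeterminates in each element, there is always a fresh one with which to mark the
argument of a function, and weak extensionality follows. When all elements share the same finite
stock of indeterminates, a constant function that is present in every grade hides any other function
with the same result, although the two differ in grade zero.
-/

namespace StrictLambda

universe u v

/-! ### Soundness -/

namespace LTerm

variable {κ : Type u} {m : Mode} {M N : LTerm κ}

theorem occ_rename_of_iff {ξ : ℕ → ℕ} {j k : ℕ} (h : ∀ n, ξ n = j ↔ n = k) :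
    occ j (rename ξ M) = occ k M := by
  induction M generalizing ξ j k with
  | var n => simp [rename, occ, h]
  | const c => rfl
  | app M N ihM ihN => simp [rename, occ, ihM h, ihN h]
  | lam _ ih => exact ih (ξ := upRen ξ) fun n => by cases n <;> simp [upRen, h]

theorem occ_rename_eq_zero {ξ : ℕ → ℕ} {j : ℕ} (h : ∀ n, ξ n ≠ j) : occ j (rename ξ M) = 0 := by
  induction M generalizing ξ j with
  | var n => simp [rename, occ, h]
  | const c => rfl
  | app M N ihM ihN => simp [rename, occ, ihM h, ihN h]
  | lam _ ih => exact ih (ξ := upRen ξ) fun n => by cases n <;> simp [upRen, h]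

theorem occ_zero_rename_upRen (M : LTerm κ) (ξ : ℕ → ℕ) :
    occ 0 (rename (upRen ξ) M) = occ 0 M :=
  occ_rename_of_iff fun n => by cases n <;> simp [upRen]

theorem WF.rename (h : WF m M) (ξ : ℕ → ℕ) : WF m (M.rename ξ) := by
  induction M generalizing ξ with
  | var n => trivial
  | const c => trivial
  | app M N ihM ihN => exact ⟨ihM h.1 ξ, ihN h.2 ξ⟩
  | lam M ih => exact ⟨ih h.1 _, by rw [occ_zero_rename_upRen]; exact h.2⟩

theorem occ_subst_of_eq {σ : ℕ → LTerm κ} {j k : ℕ}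
    (h : ∀ n, occ j (σ n) = if n = k then 1 else 0) : occ j (subst σ M) = occ k M := by
  induction M generalizing σ j k with
  | var n => simp [subst, occ, h]
  | const c => rfl
  | app M N ihM ihN => simp [subst, occ, ihM h, ihN h]
  | lam _ ih =>
    refine ih (σ := up σ) fun n => ?_
    cases n with
    | zero => simp [up, occ]
    | succ n => simp [up, occ_rename_of_iff (k := j), h]

theorem occ_zero_subst_up (M : LTerm κ) (σ : ℕ → LTerm κ) :
    occ 0 (subst (up σ) M) = occ 0 M :=
  occ_subst_of_eq fun n => by
    cases n with
    | zero => simp [up, occ]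
    | succ n => simp [up, occ_rename_eq_zero]

theorem WF.up {σ : ℕ → LTerm κ} (h : ∀ n, WF m (σ n)) : ∀ n, WF m (up σ n)
  | 0 => trivial
  | n + 1 => (h n).rename _

theorem WF.subst (h : WF m M) {σ : ℕ → LTerm κ} (hσ : ∀ n, WF m (σ n)) : WF m (M.subst σ) := by
  induction M generalizing σ with
  | var n => exact hσ n
  | const c => trivial
  | app M N ihM ihN => exact ⟨ihM h.1 hσ, ihN h.2 hσ⟩
  | lam M ih => exact ⟨ih h.1 (WF.up hσ), by rw [occ_zero_subst_up]; exact h.2⟩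

theorem WF.single (h : WF m N) : ∀ n, WF m (single N n)
  | 0 => h
  | _ + 1 => trivial

theorem Eqv.wf (h : Eqv m M N) : WF m M ∧ WF m N := by
  induction h with
  | refl h => exact ⟨h, h⟩
  | symm _ ih => exact ih.symm
  | trans _ _ ih₁ ih₂ => exact ⟨ih₁.1, ih₂.2⟩
  | app _ _ ih₁ ih₂ => exact ⟨⟨ih₁.1, ih₂.1⟩, ih₁.2, ih₂.2⟩
  | beta hM hN => exact ⟨⟨hM, hN⟩, hM.1.subst hN.single⟩
  | xi _ h₁ h₂ ih => exact ⟨⟨ih.1, h₁⟩, ih.2, h₂⟩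

end LTerm

theorem Comb.wf_toLam {κ : Type u} : ∀ {m : Mode} (c : Comb m), (c.toLam : LTerm κ).WF m
  | .linear, c => by cases c <;> simp [toLam, LTerm.WF, LTerm.occ, Mode.Admits]
  | .affine, c => by cases c <;> simp [toLam, LTerm.WF, LTerm.occ, Mode.Admits]

theorem Mode.Admits.le_one : ∀ {m : Mode} {n : ℕ}, m.Admits n → n ≤ 1
  | .linear, _, h => le_of_eq h
  | .affine, _, h => h

namespace CLTerm

variable {m : Mode} {κ : Type u} {M : CLTerm m κ}

/-- The number of occurrences of the variable `k`. -/
def occ (k : ℕ) : CLTerm m κ → ℕ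
  | .var n => if n = k then 1 else 0
  | .const _ => 0
  | .comb _ => 0
  | .app M N => occ k M + occ k N

/-- Lowers all indices by one; meant for terms in which the variable `0` does not occur. -/
def lower : CLTerm m κ → CLTerm m κ
  | .var n => .var (n - 1)
  | .const c => .const c
  | .comb c => .comb c
  | .app M N => .app (lower M) (lower N)

/-- Vacuous abstraction `K M`; the linear mode has no such term, and `M` is a junk value there. -/
def vacuous : {m : Mode} → CLTerm m κ → CLTerm m κ
  | .linear, M => M
  | .affine, M => .app (.comb .K) M

/-- Bracket abstraction of the variable `0`, which is meant to occur as the mode admits. -/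
def abs : CLTerm m κ → CLTerm m κ
  | .var 0 => .comb .I
  | .var (n + 1) => vacuous (.var n)
  | .const c => vacuous (.const c)
  | .comb c => vacuous (.comb c)
  | .app M N =>
    if occ 0 N = 0 then
      if occ 0 M = 0 then vacuous (.app M.lower N.lower)
      else .app (.app (.comb .C) (abs M)) N.lower
    else .app (.app (.comb .B) M.lower) (abs N)

theorem occ_lower (h : occ 0 M = 0) (k : ℕ) : occ k M.lower = occ (k + 1) M := by
  induction M with
  | var n =>
    cases n with
    | zero => simp [occ] at h
    | succ n => simp [occ, lower]
  | const c => rfl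
  | comb c => rfl
  | app M N ihM ihN =>
    simp only [occ, Nat.add_eq_zero_iff] at h
    simp [occ, lower, ihM h.1, ihN h.2]

theorem occ_vacuous (M : CLTerm m κ) (k : ℕ) : occ k M.vacuous = occ k M := by
  cases m <;> simp [vacuous, occ]

theorem occ_abs (h : occ 0 M ≤ 1) (k : ℕ) : occ k M.abs = occ (k + 1) M := by
  induction M with
  | var n => cases n <;> simp [occ, abs, occ_vacuous]
  | const c => simp [occ, abs, occ_vacuous]
  | comb c => simp [occ, abs, occ_vacuous]
  | app M N ihM ihN =>
    simp only [occ] at h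
    by_cases hN : occ 0 N = 0
    · by_cases hM : occ 0 M = 0
      · simp [abs, hN, hM, occ_vacuous, occ, occ_lower]
      · simp [abs, hN, hM, occ, occ_lower, ihM (by omega)]
    · have hM : occ 0 M = 0 := by omega
      simp [abs, hN, occ, occ_lower hM, ihN (by omega)]

end CLTerm

/-- The valuation `z, ρ 0, ρ 1, …`. -/
def scons {A : Type u} (z : A) (ρ : ℕ → A) : ℕ → A
  | 0 => z
  | n + 1 => ρ n

namespace CombStr

variable {m : Mode} {A : Type u} {S : CombStr m A} {M N : CLTerm m A}

theorem eval_lower (h : M.occ 0 = 0) (ρ : ℕ → A) (z : A) :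
    S.eval ρ M.lower = S.eval (scons z ρ) M := by
  induction M with
  | var n =>
    cases n with
    | zero => simp [CLTerm.occ] at h
    | succ n => rfl
  | const c => rfl
  | comb c => rfl
  | app M N ihM ihN =>
    simp only [CLTerm.occ, Nat.add_eq_zero_iff] at h
    simp [eval, CLTerm.lower, ihM h.1, ihN h.2]

theorem eval_vacuous (hS : S.IsCombAlgebra) (h : m.Admits 0) (ρ : ℕ → A) (z : A) :
    S.app (S.eval ρ M.vacuous) z = S.eval ρ M := by
  cases m
  · exact absurd h (by simp [Mode.Admits])
  · exact hS .K _ _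

theorem eval_abs (hS : S.IsCombAlgebra) (h : m.Admits (M.occ 0)) (ρ : ℕ → A) (z : A) :
    S.app (S.eval ρ M.abs) z = S.eval (scons z ρ) M := by
  induction M with
  | var n =>
    cases n with
    | zero => exact hS .I _
    | succ n => exact eval_vacuous hS h ρ z
  | const c => exact eval_vacuous hS h ρ z
  | comb c => exact eval_vacuous hS h ρ z
  | app M N ihM ihN =>
    by_cases hN : N.occ 0 = 0
    · by_cases hM : M.occ 0 = 0
      · simp only [CLTerm.occ, hM, hN] at h
        simp only [CLTerm.abs, hN, hM, if_true]
        rw [eval_vacuous hS h]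
        simp [eval, eval_lower hM ρ z, eval_lower hN ρ z]
      · simp only [CLTerm.occ, hN, add_zero] at h
        simp only [CLTerm.abs, hN, hM, if_true, if_false, eval]
        rw [hS .C, ihM h, eval_lower hN ρ z]
    · have hM : M.occ 0 = 0 := by
        have := h.le_one
        simp only [CLTerm.occ] at this
        omega
      simp only [CLTerm.occ, hM, zero_add] at h
      simp only [CLTerm.abs, hN, if_false, eval]
      rw [hS .B, ihN h, eval_lower hM ρ z]

end CombStr

namespace LTerm

variable {κ : Type v} {A : Type u} {m : Mode} {i : κ → A} {ε : A} {M : LTerm κ}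

/-- Translation into combinatory terms: bracket abstraction, followed by an application of `ε`
to choose among the elements that represent a function. -/
def toCL (m : Mode) (i : κ → A) (ε : A) : LTerm κ → CLTerm m A
  | .var n => .var n
  | .const c => .const (i c)
  | .app M N => .app (toCL m i ε M) (toCL m i ε N)
  | .lam M => .app (.const ε) (toCL m i ε M).abs

theorem occ_toCL (h : M.WF m) (k : ℕ) : (M.toCL m i ε).occ k = M.occ k := by
  induction M generalizing k with
  | var n => rfl
  | const c => rfl
  | app M N ihM ihN => simp [toCL, occ, CLTerm.occ, ihM h.1, ihN h.2]
  | lam M ih =>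
    have h0 : (M.toCL m i ε).occ 0 ≤ 1 := ih h.1 0 ▸ h.2.le_one
    simp [toCL, occ, CLTerm.occ, CLTerm.occ_abs h0, ih h.1]

end LTerm

/-- The number of arguments that the law of a combinator supplies to it. -/
def Comb.arity : {m : Mode} → Comb m → ℕ
  | _, .B => 3
  | _, .C => 3
  | _, .I => 1
  | _, .K => 2

namespace CombStr

variable {m : Mode} {A : Type u} {κ : Type v} {S : CombStr m A} {ε a : A} {i : κ → A}
  {M N : LTerm κ} {ρ ρ' : ℕ → A}

/-- `a` and the elements `a x₁ ⋯ xₖ` with `k < n` are all fixed by `ε`. -/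
def FixedUpTo (S : CombStr m A) (ε : A) : ℕ → A → Prop
  | 0, _ => True
  | n + 1, a => S.app ε a = a ∧ ∀ x, FixedUpTo S ε n (S.app a x)

/-- Combinatory `λ`-models, witnessed by `ε`, in which the combinators denote the chosen
representatives of their functions. This is what makes them sound for the `λ`-calculus. -/
structure IsStableModel (S : CombStr m A) (ε : A) : Prop where
  isCombAlgebra : S.IsCombAlgebra
  app_app : ∀ x y, S.app (S.app ε x) y = S.app x y
  weakExt : ∀ x y, (∀ z, S.app x z = S.app y z) → S.app ε x = S.app ε y
  fixed : ∀ c : Comb m, S.FixedUpTo ε c.arity (S.comb c)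

/-- The interpretation of the `λ`-term `M`, with `i` for the constants and `ρ` for the
variables. -/
def interp (S : CombStr m A) (ε : A) (i : κ → A) (ρ : ℕ → A) (M : LTerm κ) : A :=
  S.eval ρ (M.toCL m i ε)

namespace IsStableModel

theorem app_eval_abs (hS : S.IsStableModel ε) (hM : (LTerm.lam M).WF m) (ρ : ℕ → A) (z : A) :
    S.app (S.eval ρ (M.toCL m i ε).abs) z = S.interp ε i (scons z ρ) M :=
  eval_abs hS.isCombAlgebra (by rw [LTerm.occ_toCL hM.1]; exact hM.2) ρ z

theorem app_interp_lam (hS : S.IsStableModel ε) (hM : (LTerm.lam M).WF m) (ρ : ℕ → A) (z : A) :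
    S.app (S.interp ε i ρ (.lam M)) z = S.interp ε i (scons z ρ) M :=
  (hS.app_app _ z).trans (hS.app_eval_abs hM ρ z)

theorem interp_lam_congr (hS : S.IsStableModel ε) (hM : (LTerm.lam M).WF m)
    (hN : (LTerm.lam N).WF m)
    (h : ∀ z, S.interp ε i (scons z ρ) M = S.interp ε i (scons z ρ') N) :
    S.interp ε i ρ (.lam M) = S.interp ε i ρ' (.lam N) :=
  hS.weakExt _ _ fun z =>
    ((hS.app_eval_abs hM ρ z).trans (h z)).trans (hS.app_eval_abs hN ρ' z).symm

theorem eq_interp_lam (hS : S.IsStableModel ε) (hM : (LTerm.lam M).WF m) (ha : S.app ε a = a)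
    (h : ∀ z, S.app a z = S.interp ε i (scons z ρ) M) : a = S.interp ε i ρ (.lam M) :=
  ha.symm.trans (hS.weakExt _ _ fun z => (h z).trans (hS.app_eval_abs hM ρ z).symm)

theorem interp_rename (hS : S.IsStableModel ε) (hM : M.WF m) (ξ : ℕ → ℕ) (ρ : ℕ → A) :
    S.interp ε i ρ (M.rename ξ) = S.interp ε i (fun n => ρ (ξ n)) M := by
  induction M generalizing ξ ρ with
  | var n => rfl
  | const c => rfl
  | app M N ihM ihN => exact congrArg₂ S.app (ihM hM.1 ξ ρ) (ihN hM.2 ξ ρ)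
  | lam M ih =>
    refine hS.interp_lam_congr (hM.rename ξ) hM fun z => ?_
    rw [ih hM.1]
    congr 1
    funext n
    cases n <;> rfl

theorem interp_subst (hS : S.IsStableModel ε) (hM : M.WF m) {σ : ℕ → LTerm κ}
    (hσ : ∀ n, (σ n).WF m) (ρ : ℕ → A) :
    S.interp ε i ρ (M.subst σ) = S.interp ε i (fun n => S.interp ε i ρ (σ n)) M := by
  induction M generalizing σ ρ with
  | var n => rfl
  | const c => rfl
  | app M N ihM ihN => exact congrArg₂ S.app (ihM hM.1 hσ ρ) (ihN hM.2 hσ ρ)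
  | lam M ih =>
    refine hS.interp_lam_congr (hM.subst hσ) hM fun z => ?_
    rw [ih hM.1 (LTerm.WF.up hσ)]
    congr 1
    funext n
    cases n with
    | zero => rfl
    | succ n => exact hS.interp_rename (hσ n) _ _

theorem interp_inst (hS : S.IsStableModel ε) (hM : M.WF m) (hN : N.WF m) (ρ : ℕ → A) :
    S.interp ε i ρ (M.inst N) = S.interp ε i (scons (S.interp ε i ρ N) ρ) M := by
  rw [LTerm.inst, hS.interp_subst hM hN.single]
  congr 1
  funext n
  cases n <;> rfl

theorem interp_eq_of_eqv (hS : S.IsStableModel ε) (h : LTerm.Eqv m M N) (ρ : ℕ → A) :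
    S.interp ε i ρ M = S.interp ε i ρ N := by
  induction h generalizing ρ with
  | refl _ => rfl
  | symm _ ih => exact (ih ρ).symm
  | trans _ _ ih₁ ih₂ => exact (ih₁ ρ).trans (ih₂ ρ)
  | app _ _ ih₁ ih₂ => exact congrArg₂ S.app (ih₁ ρ) (ih₂ ρ)
  | beta hM hN => exact (hS.app_interp_lam hM ρ _).trans (hS.interp_inst hM.1 hN ρ).symm
  | xi h h₁ h₂ ih => exact hS.interp_lam_congr ⟨h.wf.1, h₁⟩ ⟨h.wf.2, h₂⟩ fun z => ih _

theorem comb_eq_interp_toLam (hS : S.IsStableModel ε) (c : Comb m) (ρ : ℕ → A) :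
    S.comb c = S.interp ε i ρ c.toLam := by
  have hw := c.wf_toLam (κ := κ)
  have hf := hS.fixed c
  have hlaw := hS.isCombAlgebra c
  cases c with
  | B | C =>
    exact hS.eq_interp_lam hw hf.1 fun x => hS.eq_interp_lam hw.1 (hf.2 x).1 fun y =>
      hS.eq_interp_lam hw.1.1 ((hf.2 x).2 y).1 fun z => hlaw x y z
  | I => exact hS.eq_interp_lam hw hf.1 hlaw
  | K =>
    exact hS.eq_interp_lam hw hf.1 fun x => hS.eq_interp_lam hw.1 (hf.2 x).1 fun y => hlaw x y

end IsStableModel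

section Embedding

variable {T : CombStr m κ}

theorem isCombAlgebra_of_embedding (hS : S.IsCombAlgebra) (hi : Function.Injective i)
    (happ : ∀ x y, i (T.app x y) = S.app (i x) (i y)) (hcomb : ∀ c, i (T.comb c) = S.comb c) :
    T.IsCombAlgebra := by
  intro c
  have h := hS c
  rw [← hcomb] at h
  cases c with
  | B | C => exact fun x y z => hi (by simpa only [happ] using h (i x) (i y) (i z))
  | I => exact fun x => hi (by simpa only [happ] using h (i x))
  | K => exact fun x y => hi (by simpa only [happ] using h (i x) (i y))

theorem interp_toLam_of_embedding (hS : S.IsStableModel ε)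
    (happ : ∀ x y, i (T.app x y) = S.app (i x) (i y)) (hcomb : ∀ c, i (T.comb c) = S.comb c)
    (ρ : ℕ → κ) (M : CLTerm m κ) : S.interp ε i (fun n => i (ρ n)) M.toLam = i (T.eval ρ M) := by
  induction M with
  | var n => rfl
  | const c => rfl
  | comb c => exact ((hcomb c).trans (hS.comb_eq_interp_toLam c _)).symm
  | app M N ihM ihN => exact (congrArg₂ S.app ihM ihN).trans (happ _ _).symm

theorem isLambdaAlgebra_of_embedding (hS : S.IsStableModel ε) (hi : Function.Injective i)
    (happ : ∀ x y, i (T.app x y) = S.app (i x) (i y)) (hcomb : ∀ c, i (T.comb c) = S.comb c) :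
    T.IsLambdaAlgebra := by
  refine ⟨isCombAlgebra_of_embedding hS.isCombAlgebra hi happ hcomb, fun M N _ _ h ρ => hi ?_⟩
  rw [← interp_toLam_of_embedding hS happ hcomb, ← interp_toLam_of_embedding hS happ hcomb]
  exact hS.interp_eq_of_eqv h _

end Embedding

end CombStr

/-! ### Linear graph models -/

/-- The `n`-fold arrows `arr a₁ (arr a₂ ⋯ (arr aₙ b))`. -/
def IsArrow {α : Type u} {T : Type v} (arr : α → T → T) : ℕ → T → Prop
  | 0, _ => True
  | n + 1, t => ∃ a b, IsArrow arr n b ∧ t = arr a b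

theorem isArrow_one {α : Type u} {T : Type v} {arr : α → T → T} {a : α} {b : T} :
    IsArrow arr 1 (arr a b) :=
  ⟨a, b, trivial, rfl⟩

namespace GraphModel

variable {T : Type u} {arr : T → T → T} {F G : Set T} {b : T}

/-- Application in the linear graph model on the powerset of a set `T` of tokens: the token
`arr a b` consumes the single token `a` of the argument and produces `b`. -/
def app (arr : T → T → T) (F G : Set T) : Set T := {b | ∃ a ∈ G, arr a b ∈ F}

/-- The principal types of the linear combinators. -/
def comb (arr : T → T → T) : Comb .linear → Set T
  | .B => {t | ∃ a b c, t = arr (arr c b) (arr (arr a c) (arr a b))}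
  | .C => {t | ∃ a b c, t = arr (arr a (arr c b)) (arr c (arr a b))}
  | .I => {t | ∃ b, t = arr b b}

/-- The linear graph model. -/
def alg (arr : T → T → T) : CombStr .linear (Set T) := ⟨app arr, comb arr⟩

/-- The element that keeps the arrows of its argument. -/
def eps (arr : T → T → T) : Set T := {t | ∃ a b, t = arr (arr a b) (arr a b)}

theorem isCombAlgebra (h : Function.Injective2 arr) : (alg arr).IsCombAlgebra := by
  intro c
  cases c <;> simp only [CombStr.Law, alg] <;> intros <;> ext <;>
    simp only [app, comb, Set.mem_ofPred_eq, h.eq_iff] <;> grind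

theorem mem_app_eps (h : Function.Injective2 arr) :
    b ∈ app arr (eps arr) F ↔ IsArrow arr 1 b ∧ b ∈ F := by
  simp only [app, eps, Set.mem_ofPred_eq, h.eq_iff, IsArrow]
  grind

theorem mem_app_singleton {a : T} : b ∈ app arr F {a} ↔ arr a b ∈ F := by simp [app]

theorem fixedUpTo_of_isArrow (h : Function.Injective2 arr) {n : ℕ}
    (hF : ∀ t ∈ F, IsArrow arr n t) : (alg arr).FixedUpTo (eps arr) n F := by
  induction n generalizing F with
  | zero => trivial
  | succ n ih =>
    refine ⟨Set.ext fun t => (mem_app_eps h).trans ⟨And.right, fun ht => ⟨?_, ht⟩⟩, fun G => ih ?_⟩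
    · obtain ⟨a, b, -, rfl⟩ := hF t ht
      exact isArrow_one
    · rintro b ⟨a, -, hab⟩
      obtain ⟨a', b', hb, heq⟩ := hF _ hab
      exact (h heq).2 ▸ hb

theorem isStableModel (h : Function.Injective2 arr) : (alg arr).IsStableModel (eps arr) where
  isCombAlgebra := isCombAlgebra h
  app_app F G := Set.ext fun b => by
    change (∃ a ∈ G, arr a b ∈ app arr (eps arr) F) ↔ ∃ a ∈ G, arr a b ∈ F
    simp only [mem_app_eps h, isArrow_one, true_and]
  weakExt F G hFG := Set.ext fun t => by
    have happ (a b : T) : arr a b ∈ F ↔ arr a b ∈ G := by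
      simpa only [alg, mem_app_singleton] using Set.ext_iff.mp (hFG {a}) b
    simp only [alg, mem_app_eps h]
    refine and_congr_right ?_
    rintro ⟨a, b, -, rfl⟩
    exact happ a b
  fixed c := by
    refine fixedUpTo_of_isArrow h ?_
    cases c <;> simp only [alg, comb, Comb.arity, IsArrow, Set.mem_ofPred_eq] <;> grind

end GraphModel

/-! ### Partial involutions in a graph model -/

namespace PInv

open Relation

noncomputable instance : DecidableEq Move := Classical.decEq Move

variable {f g : PInv} {a b s t : Finset Move} {u v x : Move}

/-- A set of moves on either side of an arrow: `a` on the left and `b` on the right. -/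
noncomputable def arrow (a b : Finset Move) : Finset Move := a.image .l ∪ b.image .r

@[simp] theorem l_mem_arrow : .l u ∈ arrow a b ↔ u ∈ a := by simp [arrow]

@[simp] theorem r_mem_arrow : .r u ∈ arrow a b ↔ u ∈ b := by simp [arrow]

@[simp] theorem e_notMem_arrow : .e ∉ arrow a b := by simp [arrow]

@[simp] theorem pair_notMem_arrow : .pair u v ∉ arrow a b := by simp [arrow]

theorem arrow_injective2 : Function.Injective2 arrow := fun _ _ _ _ h =>
  ⟨Finset.ext fun u => by simpa using Finset.ext_iff.mp h (.l u),
    Finset.ext fun u => by simpa using Finset.ext_iff.mp h (.r u)⟩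

theorem arrow_subset_arrow (ha : a ⊆ s) (hb : b ⊆ t) : arrow a b ⊆ arrow s t :=
  Finset.union_subset_union (Finset.image_subset_image ha) (Finset.image_subset_image hb)

/-- `f` is defined on all of `s` and maps it to itself. -/
def Preserves (f : PInv) (s : Finset Move) : Prop := ∀ u ∈ s, ∃ v ∈ s, f.rel u v

/-- The finite sets preserved by `f`: the tokens of `f` in the graph model with arrows `arrow`. -/
def tokens (f : PInv) : Set (Finset Move) := {s | f.Preserves s}

theorem Preserves.mem_of_rel (h : f.Preserves s) (hu : u ∈ s) (huv : f.rel u v) : v ∈ s := by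
  obtain ⟨w, hw, huw⟩ := h u hu
  exact f.functional _ _ _ huv huw ▸ hw

theorem Preserves.mem_iff (h : f.Preserves s) (huv : f.rel u v) : u ∈ s ↔ v ∈ s :=
  ⟨fun hu => h.mem_of_rel hu huv, fun hv => h.mem_of_rel hv (f.symm _ _ huv)⟩

theorem preserves_of_forall_exists_subset (h : ∀ u ∈ s, ∃ t ⊆ s, u ∈ t ∧ f.Preserves t) :
    f.Preserves s := by
  intro u hu
  obtain ⟨t, hts, hut, ht⟩ := h u hu
  obtain ⟨v, hv, huv⟩ := ht u hut
  exact ⟨v, hts hv, huv⟩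

theorem preserves_pair (h : f.rel u v) : f.Preserves {u, v} := by
  simp only [Preserves, Finset.mem_insert, Finset.mem_singleton]
  rintro w (rfl | rfl)
  · exact ⟨v, .inr rfl, h⟩
  · exact ⟨u, .inl rfl, f.symm _ _ h⟩

theorem rel_iff_preserves : f.rel u v ↔ f.Preserves {u, v} ∧ (f.Preserves {u} → u = v) := by
  refine ⟨fun h => ⟨preserves_pair h, fun hu => ?_⟩, fun ⟨huv, hu⟩ => ?_⟩
  · exact (Finset.mem_singleton.mp (hu.mem_of_rel (Finset.mem_singleton_self u) h)).symm
  · obtain ⟨w, hw, huw⟩ := huv u (by simp)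
    obtain rfl | rfl : w = u ∨ w = v := by simpa using hw
    · have hw : f.Preserves {w} := by simpa [Preserves] using huw
      exact hu hw ▸ huw
    · exact huw

theorem tokens_injective : Function.Injective tokens := by
  intro f g h
  have hpres (s : Finset Move) : f.Preserves s ↔ g.Preserves s := Set.ext_iff.mp h s
  ext u v
  simp only [rel_iff_preserves, hpres]

theorem Preserves.ext (hs : f.Preserves s) (ht : f.Preserves t)
    (h : ∀ u v, f.rel u v → ((u ∈ s ↔ u ∈ t) ∨ (v ∈ s ↔ v ∈ t))) : s = t := by
  have hst (u v : Move) (huv : f.rel u v) : u ∈ s ↔ u ∈ t :=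
    (h u v huv).elim id fun hv => (hs.mem_iff huv).trans (hv.trans (ht.mem_iff huv).symm)
  ext u
  constructor
  · intro hu
    obtain ⟨v, -, huv⟩ := hs u hu
    exact (hst u v huv).mp hu
  · intro hu
    obtain ⟨v, -, huv⟩ := ht u hu
    exact (hst u v huv).mpr hu

/-- The moves on the left of an arrow. -/
noncomputable def left (t : Finset Move) : Finset Move := t.preimage .l fun _ _ _ _ => Move.l.inj

/-- The moves on the right of an arrow. -/
noncomputable def right (t : Finset Move) : Finset Move := t.preimage .r fun _ _ _ _ => Move.r.inj

@[simp] theorem mem_left : u ∈ left t ↔ .l u ∈ t := Finset.mem_preimage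

@[simp] theorem mem_right : u ∈ right t ↔ .r u ∈ t := Finset.mem_preimage

theorem B_preserves_arrow (a b c : Finset Move) :
    B.Preserves (arrow (arrow c b) (arrow (arrow a c) (arrow a b))) := by
  rintro (_ | (_ | x | x | _) | (_ | (_ | x | x | _) | (_ | x | x | _) | _) | _) hu <;>
    simp only [l_mem_arrow, r_mem_arrow, e_notMem_arrow, pair_notMem_arrow] at hu
  · exact ⟨.r (.l (.r x)), by simpa using hu, .inl (.two x)⟩
  · exact ⟨.r (.r (.r x)), by simpa using hu, .inr (.one x)⟩
  · exact ⟨.r (.r (.l x)), by simpa using hu, .inl (.three x)⟩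
  · exact ⟨.l (.l x), by simpa using hu, .inr (.two x)⟩
  · exact ⟨.r (.l (.l x)), by simpa using hu, .inr (.three x)⟩
  · exact ⟨.l (.r x), by simpa using hu, .inl (.one x)⟩

theorem C_preserves_arrow (a b c : Finset Move) :
    C.Preserves (arrow (arrow a (arrow c b)) (arrow c (arrow a b))) := by
  rintro (_ | (_ | x | (_ | x | x | _) | _) | (_ | x | (_ | x | x | _) | _) | _) hu <;>
    simp only [l_mem_arrow, r_mem_arrow, e_notMem_arrow, pair_notMem_arrow] at hu
  · exact ⟨.r (.r (.l x)), by simpa using hu, .inl (.one x)⟩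
  · exact ⟨.r (.l x), by simpa using hu, .inl (.two x)⟩
  · exact ⟨.r (.r (.r x)), by simpa using hu, .inl (.three x)⟩
  · exact ⟨.l (.r (.l x)), by simpa using hu, .inr (.two x)⟩
  · exact ⟨.l (.l x), by simpa using hu, .inr (.one x)⟩
  · exact ⟨.l (.r (.r x)), by simpa using hu, .inr (.three x)⟩

theorem I_preserves_arrow (b : Finset Move) : I.Preserves (arrow b b) := by
  rintro (_ | x | x | _) hu <;>
    simp only [l_mem_arrow, r_mem_arrow, e_notMem_arrow, pair_notMem_arrow] at hu
  · exact ⟨.r x, by simpa using hu, .inl (.one x)⟩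
  · exact ⟨.l x, by simpa using hu, .inr (.one x)⟩

theorem tokens_comb (c : Comb .linear) : tokens (alg.comb c) = GraphModel.comb arrow c := by
  ext t
  cases c with
  | B =>
    refine ⟨fun ht => ⟨left (left (right t)), right (left t), left (left t), ?_⟩, ?_⟩
    · exact Preserves.ext ht (B_preserves_arrow _ _ _) (by rintro u v (h | h) <;> cases h <;> simp)
    · rintro ⟨a, b, c, rfl⟩
      exact B_preserves_arrow a b c
  | C =>
    refine ⟨fun ht =>
      ⟨left (left t), right (right (left t)), left (right (left t)), ?_⟩, ?_⟩
    · exact Preserves.ext ht (C_preserves_arrow _ _ _) (by rintro u v (h | h) <;> cases h <;> simp)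
    · rintro ⟨a, b, c, rfl⟩
      exact C_preserves_arrow a b c
  | I =>
    refine ⟨fun ht => ⟨left t, ?_⟩, ?_⟩
    · exact Preserves.ext ht (I_preserves_arrow _) (by rintro u v (h | h) <;> cases h <;> simp)
    · rintro ⟨b, rfl⟩
      exact I_preserves_arrow b

/-- `Run f g x v`: fed the move `x`, the feedback loop that answers by `g` and then by the left
side of `f` finally leaves through `v` on the right side of `f`. -/
inductive Run (f g : PInv) : Move → Move → Prop
  | exit {x y v : Move} : g.rel x y → f.rel (.l y) (.r v) → Run f g x v
  | loop {x y x' v : Move} : g.rel x y → f.rel (.l y) (.l x') → Run f g x' v → Run f g x v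

theorem run_iff : Run f g u v ↔
    ∃ x y, g.rel u x ∧ ReflTransGen (Comp (f.sub .l .l) g.rel) x y ∧ f.rel (.l y) (.r v) := by
  constructor
  · intro h
    induction h with
    | exit hg hf => exact ⟨_, _, hg, .refl, hf⟩
    | loop hg hf _ ih =>
      obtain ⟨x, y, hx, hxy, hy⟩ := ih
      exact ⟨_, y, hg, .head ⟨_, hf, hx⟩ hxy, hy⟩
  · rintro ⟨x, y, hux, hxy, hyv⟩
    induction hxy using ReflTransGen.head_induction_on generalizing u with
    | refl => exact .exit hux hyv
    | head h _ ih =>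
      obtain ⟨x', hf, hg⟩ := h
      exact .loop hux hf (ih hg)

theorem app_rel_iff :
    (f.app g).rel u v ↔ f.rel (.r u) (.r v) ∨ ∃ x, f.rel (.r u) (.l x) ∧ Run f g x v := by
  refine or_congr_right ⟨?_, ?_⟩
  · rintro ⟨y, ⟨x, ⟨w, hf, hg⟩, hxy⟩, hy⟩
    exact ⟨w, hf, run_iff.mpr ⟨x, y, hg, hxy, hy⟩⟩
  · rintro ⟨w, hf, hrun⟩
    obtain ⟨x, y, hg, hxy, hy⟩ := run_iff.mp hrun
    exact ⟨y, ⟨x, ⟨w, hf, hg⟩, hxy⟩, hy⟩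

theorem Run.exists_finset (h : Run f g x v) : ∃ a, x ∈ a ∧ g.Preserves a ∧
    (∀ y ∈ a, y = x ∨ ∃ z ∈ arrow a {v}, f.rel (.l y) z) ∧
      ∃ z ∈ arrow a {v}, f.rel (.r v) z := by
  induction h with
  | @exit x y v hg hf =>
    refine ⟨{x, y}, by simp, preserves_pair hg, ?_, .l y, by simp, f.symm _ _ hf⟩
    simp only [Finset.mem_insert, Finset.mem_singleton]
    rintro w (rfl | rfl)
    · exact .inl rfl
    · exact .inr ⟨.r v, by simp, hf⟩
  | @loop x y x' v hg hf _ ih =>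
    obtain ⟨a, hx', hga, hfa, z, hz, hvz⟩ := ih
    have hsub : arrow a {v} ⊆ arrow ({x, y} ∪ a) {v} :=
      arrow_subset_arrow Finset.subset_union_right subset_rfl
    refine ⟨{x, y} ∪ a, by simp, ?_, ?_, z, hsub hz, hvz⟩
    · refine preserves_of_forall_exists_subset fun w hw => ?_
      rcases Finset.mem_union.mp hw with hw | hw
      · exact ⟨_, Finset.subset_union_left, hw, preserves_pair hg⟩
      · exact ⟨_, Finset.subset_union_right, hw, hga⟩
    · simp only [Finset.mem_union, Finset.mem_insert, Finset.mem_singleton]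
      rintro w ((rfl | rfl) | hw)
      · exact .inl rfl
      · exact .inr ⟨.l x', by simp [hx'], hf⟩
      · rcases hfa w hw with rfl | ⟨z, hz, hwz⟩
        · exact .inr ⟨.l y, by simp, f.symm _ _ hf⟩
        · exact .inr ⟨z, hsub hz, hwz⟩

theorem exists_preserves_of_app_rel (h : (f.app g).rel u v) :
    ∃ a, g.Preserves a ∧ f.Preserves (arrow a {u, v}) := by
  rcases app_rel_iff.mp h with hf | ⟨x, hf, hrun⟩
  · have harrow : arrow ∅ {u, v} = {.r u, .r v} := by simp [arrow, Finset.image_insert]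
    exact ⟨∅, by simp [Preserves], harrow ▸ preserves_pair hf⟩
  · obtain ⟨a, hx, hga, hfa, hv⟩ := hrun.exists_finset
    have hsub : arrow a {v} ⊆ arrow a {u, v} := arrow_subset_arrow subset_rfl (by simp)
    refine ⟨a, hga, ?_⟩
    rintro (_ | y | w | _) hy <;>
    simp only [l_mem_arrow, r_mem_arrow, e_notMem_arrow, pair_notMem_arrow, Finset.mem_insert,
      Finset.mem_singleton] at hy
    · rcases hfa y hy with rfl | ⟨z, hz, hyz⟩
      · exact ⟨.r u, by simp, f.symm _ _ hf⟩
      · exact ⟨z, hsub hz, hyz⟩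
    · rcases hy with rfl | rfl
      · exact ⟨.l x, by simpa using hx, hf⟩
      · obtain ⟨z, hz, hvz⟩ := hv
        exact ⟨z, hsub hz, hvz⟩

theorem exists_preserves_of_app_preserves (h : (f.app g).Preserves b) :
    ∃ a, g.Preserves a ∧ f.Preserves (arrow a b) := by
  choose! v hv hrel using h
  choose! a hga hfa using fun u hu => exists_preserves_of_app_rel (hrel u hu)
  have hsub {u : Move} (hu : u ∈ b) : arrow (a u) {u, v u} ⊆ arrow (b.biUnion a) b :=
    arrow_subset_arrow (Finset.subset_biUnion_of_mem a hu)
      (by simp [Finset.insert_subset_iff, hu, hv u hu])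
  refine ⟨b.biUnion a, ?_, ?_⟩ <;> refine preserves_of_forall_exists_subset ?_
  · intro y hy
    obtain ⟨u, hu, hyu⟩ := Finset.mem_biUnion.mp hy
    exact ⟨a u, Finset.subset_biUnion_of_mem a hu, hyu, hga u hu⟩
  · rintro (_ | y | u | _) hy <;>
    simp only [l_mem_arrow, r_mem_arrow, e_notMem_arrow, pair_notMem_arrow,
      Finset.mem_biUnion] at hy
    · obtain ⟨u, hu, hyu⟩ := hy
      exact ⟨_, hsub hu, by simpa using hyu, hfa u hu⟩
    · exact ⟨_, hsub hy, by simp, hfa u hy⟩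

theorem exists_run (hf : f.Preserves (arrow a b)) (hg : g.Preserves a) (hx : x ∈ a)
    (hux : f.rel (.r u) (.l x)) : ∃ v ∈ b, Run f g x v := by
  classical
  by_contra! hstuck
  let N := a.filter fun x => ∀ v ∈ b, ¬ Run f g x v
  have hnext (x) (hx : x ∈ N) : ∃ x' ∈ N, ∃ y, g.rel x y ∧ f.rel (.l y) (.l x') := by
    obtain ⟨hxa, hxN⟩ := Finset.mem_filter.mp hx
    obtain ⟨y, hya, hxy⟩ := hg x hxa
    obtain ⟨_ | x' | v | _, hz, hyz⟩ := hf (.l y) (by simpa using hya) <;>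
    simp only [l_mem_arrow, r_mem_arrow, e_notMem_arrow, pair_notMem_arrow] at hz
    · exact ⟨x', Finset.mem_filter.mpr ⟨hz, fun v hv h => hxN v hv (.loop hxy hyz h)⟩, y, hxy, hyz⟩
    · exact absurd (.exit hxy hyz) (hxN v hz)
  choose! φ hφN ψ hgψ hfψ using hnext
  have hinj : Set.InjOn φ N := by
    intro w hw w' hw' h
    have hy : ψ w = ψ w' := Move.l.inj <| f.functional _ _ _ (f.symm _ _ (hfψ w hw)) <|
      h ▸ f.symm _ _ (hfψ w' hw')
    exact g.functional _ _ _ (g.symm _ _ (hgψ w hw)) (hy ▸ g.symm _ _ (hgψ w' hw'))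
  obtain ⟨w, hw, rfl⟩ := Finset.surjOn_of_injOn_of_card_le φ hφN hinj le_rfl
    (Finset.mem_filter.mpr ⟨hx, hstuck⟩)
  exact nomatch f.functional _ _ _ (f.symm _ _ hux) (f.symm _ _ (hfψ w hw))

theorem app_preserves (hf : f.Preserves (arrow a b)) (hg : g.Preserves a) :
    (f.app g).Preserves b := by
  intro u hu
  obtain ⟨_ | x | v | _, hz, huz⟩ := hf (.r u) (by simpa using hu) <;>
    simp only [l_mem_arrow, r_mem_arrow, e_notMem_arrow, pair_notMem_arrow] at hz
  · obtain ⟨v, hv, hrun⟩ := exists_run hf hg hz huz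
    exact ⟨v, hv, app_rel_iff.mpr (.inr ⟨x, huz, hrun⟩)⟩
  · exact ⟨v, hz, app_rel_iff.mpr (.inl huz)⟩

theorem tokens_app (f g : PInv) : tokens (f.app g) = GraphModel.app arrow (tokens f) (tokens g) :=
  Set.ext fun _ => ⟨exists_preserves_of_app_preserves, fun ⟨_, hg, hf⟩ => app_preserves hf hg⟩

theorem alg_isLambdaAlgebra : alg.IsLambdaAlgebra :=
  CombStr.isLambdaAlgebra_of_embedding (GraphModel.isStableModel arrow_injective2)
    tokens_injective tokens_app tokens_comb

end PInv

/-! ### Partial involutions without weak extensionality -/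

namespace PInv

variable {f ε : PInv} {a b u v : Move}

/-- The nowhere defined partial involution. -/
def empty : PInv where
  rel _ _ := False
  functional _ _ _ h := h.elim
  symm _ _ h := h

/-- The partial involution that exchanges `a` and `b` and is undefined elsewhere. -/
def swap (a b : Move) : PInv where
  rel u v := u = a ∧ v = b ∨ u = b ∧ v = a
  functional := by grind
  symm := by grind

theorem app_empty_rel : (f.app empty).rel u v ↔ f.rel (.r u) (.r v) := by
  rw [app_rel_iff]
  refine or_iff_left ?_
  rintro ⟨x, -, h | h⟩ <;> contradiction

theorem app_swap_rel_of_path (hu : f.rel (.r u) (.l a)) (hv : f.rel (.l b) (.r v)) :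
    (f.app (swap a b)).rel u v :=
  app_rel_iff.mpr (.inr ⟨a, hu, .exit (.inl ⟨rfl, rfl⟩) hv⟩)

theorem rel_of_app_swap_rel (h : (f.app (swap a b)).rel u v) :
    f.rel (.r u) (.r v) ∨ f.rel (.r u) (.l a) ∨ f.rel (.r u) (.l b) := by
  obtain h | ⟨x, hx, h⟩ := app_rel_iff.mp h
  · exact .inl h
  · cases h with
    | exit hg _ | loop hg _ _ => obtain ⟨rfl, -⟩ | ⟨rfl, -⟩ := hg <;> simp [hx]

theorem app_eq_empty (hf : ∀ u v, ¬ f.rel (.r u) v) (g : PInv) : f.app g = empty := by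
  ext u v
  exact iff_of_false (fun h => (app_rel_iff.mp h).elim (hf _ _) fun ⟨_, h, _⟩ => hf _ _ h) id

section Representative

variable (hε : ∀ f g : PInv, (ε.app f).app g = f.app g)
include hε

theorem app_swap_rel_r_l (u v : Move) : (ε.app (swap (.l u) (.r v))).rel (.r v) (.l u) := by
  have h : ((ε.app (swap (.l u) (.r v))).app (swap u u)).rel v v := by
    rw [hε]
    exact app_swap_rel_of_path (.inr ⟨rfl, rfl⟩) (.inl ⟨rfl, rfl⟩)
  obtain h | h := rel_of_app_swap_rel h
  · have hempty := app_empty_rel.mpr h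
    rw [hε, app_empty_rel] at hempty
    simp [swap] at hempty
  · exact h.elim id id

theorem rel_r_r_l_r (v : Move) : ε.rel (.r (.r v)) (.l (.r v)) := by
  have h (u : Move) := rel_of_app_swap_rel (app_swap_rel_r_l hε u v)
  have hunique := ε.functional (.r (.r v))
  grind [h .e, h (.l .e)]

theorem rel_l_l_r_l (u : Move) : ε.rel (.l (.l u)) (.r (.l u)) := by
  have hin := rel_r_r_l_r hε .e
  obtain h | ⟨x, hx, h⟩ := app_rel_iff.mp (app_swap_rel_r_l hε u .e)
  · exact nomatch ε.functional _ _ _ hin h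
  obtain rfl := Move.l.inj (ε.functional _ _ _ hin hx)
  cases h with
  | exit hg hf =>
    obtain rfl : _ = Move.l u := by simpa [swap] using hg
    exact hf
  | loop hg hf h =>
    obtain rfl : _ = Move.l u := by simpa [swap] using hg
    -- A second round would pass through `l (r e)`, which `ε` sends back to `r (r e)`.
    cases h with
    | exit hg hf' | loop hg hf' _ => grind [swap, ε.symm, ε.functional]

end Representative

theorem alg_not_isCombinatoryModel : ¬ alg.IsCombinatoryModel := by
  rintro ⟨-, ε, hε, hext⟩
  have hin : ε.rel (.l (.l .e)) (.r (.l .e)) := rel_l_l_r_l hε .e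
  have heq : ε.app (swap (.l .e) (.l .e)) = ε.app empty :=
    hext _ _ fun g => (app_eq_empty (by simp [swap]) g).trans (app_eq_empty (fun _ _ => id) g).symm
  have h : (ε.app (swap (.l .e) (.l .e))).rel (.l .e) (.l .e) :=
    app_swap_rel_of_path (ε.symm _ _ hin) hin
  rw [heq, app_empty_rel] at h
  exact nomatch ε.functional _ _ _ (ε.symm _ _ hin) h

end PInv

/-! ### Affine graph models -/

/-- The tokens of the affine graph model: the arrow `arr none b` produces `b` without using its
argument, and `arr (some a) b` consumes the token `a` of it. -/
inductive Token : Type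
  | atom : Token
  | arr (a : Option Token) (b : Token) : Token

/-- Sets of tokens graded by multisets of indeterminates. -/
abbrev GSet : Type := Token → Multiset ℕ → Prop

namespace GSet

open Token

variable {f f' g g' : GSet} {ρ : Token → Token → Prop} {a b t : Token} {s s' : Multiset ℕ}
  {n k : ℕ}

/-- What an arrow with source `a` consumes of its argument: nothing for `a = none`. -/
def arg (g : GSet) : Option Token → Multiset ℕ → Prop
  | none, s => s = 0
  | some a, s => g a s

/-- Application in the affine graph model; the grades of a function and of the consumed part of
its argument add up. -/
def app (f g : GSet) : GSet := fun b s => ∃ a s₁ s₂, f (arr a b) s₁ ∧ arg g a s₂ ∧ s₁ + s₂ = s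

/-- The element of trivial grade that turns a token `a` of its argument into `b` if `ρ a b`. -/
def rewrite (ρ : Token → Token → Prop) : GSet :=
  fun t s => s = 0 ∧ ∃ a b, ρ a b ∧ t = arr (some a) b

/-- The rewriting rules of the affine combinators. -/
inductive Rule : Comb .affine → Token → Token → Prop
  | B_none (b : Token) : Rule .B (arr none b) (arr none (arr none b))
  | B_some (a : Option Token) (b c : Token) :
      Rule .B (arr (some c) b) (arr (some (arr a c)) (arr a b))
  | C (a c : Option Token) (b : Token) : Rule .C (arr a (arr c b)) (arr c (arr a b))
  | I (b : Token) : Rule .I b b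
  | K (b : Token) : Rule .K b (arr none b)

/-- The rule of the element that keeps the arrows of its argument. -/
inductive ArrowRule : Token → Token → Prop
  | arr (a : Option Token) (b : Token) : ArrowRule (arr a b) (arr a b)

/-- All indeterminates in the grades are below `n`. -/
def Bdd (n : ℕ) (f : GSet) : Prop := ∀ a s, f a s → ∀ i ∈ s, i < n

theorem Bdd.mono (h : Bdd n f) (hk : n ≤ k) : Bdd k f :=
  fun a s hs i hi => (h a s hs i hi).trans_le hk

theorem Bdd.app (hf : Bdd n f) (hg : Bdd n g) : Bdd n (f.app g) := by
  rintro b _ ⟨a, s₁, s₂, h₁, h₂, rfl⟩ i hi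
  rcases Multiset.mem_add.mp hi with hi | hi
  · exact hf _ _ h₁ i hi
  · cases a with
    | none => exact absurd hi (by simp [show s₂ = 0 from h₂])
    | some a => exact hg _ _ h₂ i hi

theorem bdd_rewrite (n : ℕ) (ρ : Token → Token → Prop) : Bdd n (rewrite ρ) := by
  rintro a _ ⟨rfl, -⟩ i hi
  exact absurd hi (Multiset.notMem_zero i)

theorem rewrite_app : (rewrite ρ).app g b s ↔ ∃ a, ρ a b ∧ g a s := by
  constructor
  · rintro ⟨_, _, s₂, ⟨rfl, a, b, h, ⟨⟩⟩, hg, rfl⟩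
    exact ⟨a, h, by simpa [arg] using hg⟩
  · rintro ⟨a, h, hg⟩
    exact ⟨some a, 0, s, ⟨rfl, a, b, h, rfl⟩, hg, zero_add s⟩

theorem rewrite_B_app_app {a : Option Token} :
    ((rewrite (Rule .B)).app f).app g (arr a b) s ↔
      (a = none ∧ f (arr none b) s) ∨
        ∃ c s₁ s₂, f (arr (some c) b) s₁ ∧ g (arr a c) s₂ ∧ s₁ + s₂ = s := by
  constructor
  · rintro ⟨a', s₁, s₂, h, hg, rfl⟩
    obtain ⟨t, hρ, hf⟩ := rewrite_app.mp h
    cases hρ with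
    | B_none => exact .inl ⟨rfl, by simpa [show s₂ = 0 from hg] using hf⟩
    | B_some _ _ c => exact .inr ⟨c, s₁, s₂, hf, hg, rfl⟩
  · rintro (⟨rfl, hf⟩ | ⟨c, s₁, s₂, hf, hg, rfl⟩)
    · exact ⟨none, s, 0, rewrite_app.mpr ⟨_, .B_none b, hf⟩, rfl, add_zero s⟩
    · exact ⟨_, s₁, s₂, rewrite_app.mpr ⟨_, .B_some a b c, hf⟩, hg, rfl⟩

theorem rewrite_B_app_app_app (f g h : GSet) :
    (((rewrite (Rule .B)).app f).app g).app h = f.app (g.app h) := by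
  ext b s
  constructor
  · rintro ⟨a, s, s₃, hfg, hh, rfl⟩
    obtain ⟨rfl, hf⟩ | ⟨c, s₁, s₂, hf, hg, rfl⟩ := rewrite_B_app_app.mp hfg
    · exact ⟨none, s, s₃, hf, hh, rfl⟩
    · exact ⟨some c, s₁, s₂ + s₃, hf, ⟨a, s₂, s₃, hg, hh, rfl⟩, (add_assoc _ _ _).symm⟩
  · rintro ⟨_ | c, s₁, s, hf, hgh, rfl⟩
    · exact ⟨none, s₁, s, rewrite_B_app_app.mpr (.inl ⟨rfl, hf⟩), hgh, rfl⟩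
    · obtain ⟨a, s₂, s₃, hg, hh, rfl⟩ := hgh
      exact ⟨a, s₁ + s₂, s₃, rewrite_B_app_app.mpr (.inr ⟨c, s₁, s₂, hf, hg, rfl⟩), hh,
        add_assoc _ _ _⟩

theorem rewrite_C_app_app {a : Option Token} :
    ((rewrite (Rule .C)).app f).app g (arr a b) s ↔
      ∃ c s₁ s₂, f (arr a (arr c b)) s₁ ∧ arg g c s₂ ∧ s₁ + s₂ = s := by
  constructor
  · rintro ⟨c, s₁, s₂, h, hg, rfl⟩
    obtain ⟨t, ⟨⟩, hf⟩ := rewrite_app.mp h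
    exact ⟨c, s₁, s₂, hf, hg, rfl⟩
  · rintro ⟨c, s₁, s₂, hf, hg, rfl⟩
    exact ⟨c, s₁, s₂, rewrite_app.mpr ⟨_, .C a c b, hf⟩, hg, rfl⟩

theorem rewrite_C_app_app_app (f g h : GSet) :
    (((rewrite (Rule .C)).app f).app g).app h = (f.app h).app g := by
  ext b s
  constructor
  · rintro ⟨a, s, s₃, hfg, hh, rfl⟩
    obtain ⟨c, s₁, s₂, hf, hg, rfl⟩ := rewrite_C_app_app.mp hfg
    exact ⟨c, s₁ + s₃, s₂, ⟨a, s₁, s₃, hf, hh, rfl⟩, hg, add_right_comm _ _ _⟩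
  · rintro ⟨c, s, s₂, ⟨a, s₁, s₃, hf, hh, rfl⟩, hg, rfl⟩
    exact ⟨a, s₁ + s₂, s₃, rewrite_C_app_app.mpr ⟨c, s₁, s₂, hf, hg, rfl⟩, hh,
      add_right_comm _ _ _⟩

theorem rewrite_I_app (f : GSet) : (rewrite (Rule .I)).app f = f := by
  ext b s
  refine rewrite_app.trans ⟨?_, fun h => ⟨b, .I b, h⟩⟩
  rintro ⟨_, ⟨⟩, h⟩
  exact h

theorem rewrite_K_app_app (f g : GSet) : ((rewrite (Rule .K)).app f).app g = f := by
  ext b s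
  constructor
  · rintro ⟨a, s₁, s₂, h, hg, rfl⟩
    obtain ⟨_, ⟨⟩, hf⟩ := rewrite_app.mp h
    simpa [show s₂ = 0 from hg] using hf
  · exact fun hf => ⟨none, s, 0, rewrite_app.mpr ⟨b, .K b, hf⟩, rfl, add_zero s⟩

theorem rewrite_arrowRule_app :
    (rewrite ArrowRule).app f t s ↔ IsArrow arr 1 t ∧ f t s := by
  refine rewrite_app.trans ⟨?_, ?_⟩
  · rintro ⟨_, ⟨⟩, h⟩
    exact ⟨isArrow_one, h⟩
  · rintro ⟨⟨a, b, -, rfl⟩, h⟩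
    exact ⟨_, .arr a b, h⟩

theorem rewrite_arrowRule_app_app (f g : GSet) :
    ((rewrite ArrowRule).app f).app g = f.app g := by
  ext b s
  change (∃ a s₁ s₂, (rewrite ArrowRule).app f (arr a b) s₁ ∧ _) ↔ _
  simp only [rewrite_arrowRule_app, isArrow_one, true_and]
  rfl

/-- The element whose only token is `a`, with grade `s`. -/
def single (a : Token) (s : Multiset ℕ) : GSet := fun b t => b = a ∧ t = s

theorem bdd_single (a : Token) (h : ∀ i ∈ s, i < n) : Bdd n (single a s) := by
  rintro _ _ ⟨-, rfl⟩
  exact h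

theorem Bdd.sup (hf : Bdd n f) (hg : Bdd n g) : Bdd n (f ⊔ g) :=
  fun a s h => h.elim (hf a s) (hg a s)

theorem bdd_bot (n : ℕ) : Bdd n ⊥ := fun _ _ h => h.elim

theorem app_bot : f.app ⊥ b s ↔ f (arr none b) s := by
  constructor
  · rintro ⟨_ | a, s₁, s₂, hf, hs, rfl⟩
    · simpa [show s₂ = 0 from hs] using hf
    · exact hs.elim
  · exact fun hf => ⟨none, s, 0, hf, rfl, add_zero s⟩

theorem app_single : f.app (single a s') b s ↔
    f (arr none b) s ∨ ∃ s₁, f (arr (some a) b) s₁ ∧ s₁ + s' = s := by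
  constructor
  · rintro ⟨_ | _, s₁, s₂, hf, hs, rfl⟩
    · exact .inl (by simpa [show s₂ = 0 from hs] using hf)
    · obtain ⟨rfl, rfl⟩ := hs
      exact .inr ⟨s₁, hf, rfl⟩
  · rintro (hf | ⟨s₁, hf, rfl⟩)
    · exact ⟨none, s, 0, hf, rfl, add_zero s⟩
    · exact ⟨some a, s₁, s', hf, ⟨rfl, rfl⟩, rfl⟩

-- The fresh indeterminate `n` marks the outputs that used the argument.
theorem app_single_fresh (hf : Bdd n f) :
    f.app (single a {n}) b (s + {n}) ↔ f (arr (some a) b) s := by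
  rw [app_single, or_iff_right fun h => lt_irrefl n (hf _ _ h n (by simp))]
  simp

theorem app_mono (hf : f ≤ f') (hg : g ≤ g') : f.app g ≤ f'.app g' := by
  rintro b s ⟨_ | a, s₁, s₂, h₁, h₂, hs⟩
  · exact ⟨none, s₁, s₂, hf _ _ h₁, h₂, hs⟩
  · exact ⟨some a, s₁, s₂, hf _ _ h₁, hg _ _ h₂, hs⟩

theorem app_zero_mono (hg : ∀ a, g a 0 → g' a 0) (h : f.app g b 0) : f.app g' b 0 := by
  obtain ⟨a, s₁, s₂, h₁, h₂, hs⟩ := h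
  obtain ⟨rfl, rfl⟩ := add_eq_zero.mp hs
  cases a with
  | none => exact ⟨none, 0, 0, h₁, rfl, hs⟩
  | some a => exact ⟨some a, 0, 0, h₁, hg a h₂, hs⟩

/-- The graded sets in finitely many indeterminates. -/
def full : CombStr .affine {f : GSet // ∃ n, Bdd n f} where
  app f g := ⟨f.1.app g.1, by
    obtain ⟨⟨f, n, hf⟩, ⟨g, k, hg⟩⟩ := f, g
    exact ⟨max n k, (hf.mono (le_max_left n k)).app (hg.mono (le_max_right n k))⟩⟩
  comb c := ⟨rewrite (Rule c), 0, bdd_rewrite 0 _⟩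

/-- The graded sets in the indeterminates below `n`. -/
def bounded (n : ℕ) : CombStr .affine {f : GSet // Bdd n f} where
  app f g := ⟨f.1.app g.1, f.2.app g.2⟩
  comb c := ⟨rewrite (Rule c), bdd_rewrite n _⟩

/-- The element of `full` that keeps the arrows of its argument. -/
def eps : {f : GSet // ∃ n, Bdd n f} := ⟨rewrite ArrowRule, 0, bdd_rewrite 0 _⟩

theorem full_isCombAlgebra : full.IsCombAlgebra := by
  intro c
  cases c with
  | B => exact fun f g h => Subtype.ext (rewrite_B_app_app_app f.1 g.1 h.1)
  | C => exact fun f g h => Subtype.ext (rewrite_C_app_app_app f.1 g.1 h.1)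
  | I => exact fun f => Subtype.ext (rewrite_I_app f.1)
  | K => exact fun f g => Subtype.ext (rewrite_K_app_app f.1 g.1)

theorem full_fixedUpTo_of_isArrow {f : {f : GSet // ∃ n, Bdd n f}}
    (hf : ∀ t s, f.1 t s → IsArrow arr n t) : full.FixedUpTo eps n f := by
  induction n generalizing f with
  | zero => trivial
  | succ n ih =>
    refine ⟨?_, fun g => ih ?_⟩
    · ext t s
      refine rewrite_arrowRule_app.trans ⟨And.right, fun h => ⟨?_, h⟩⟩
      obtain ⟨a, b, -, rfl⟩ := hf t s h
      exact isArrow_one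
    · rintro b s ⟨a, s₁, -, h, -⟩
      obtain ⟨a', b', hb, ⟨⟩⟩ := hf _ _ h
      exact hb

theorem Rule.isArrow {c : Comb .affine} (h : Rule c a b) :
    IsArrow arr c.arity (arr (some a) b) := by
  cases h <;> simp [IsArrow, Comb.arity]

theorem apply_arr_iff_of_app_eq (hf : Bdd n f) (hg : Bdd n g)
    (h : ∀ z, Bdd (n + 1) z → f.app z = g.app z) (a : Option Token) :
    f (arr a b) s ↔ g (arr a b) s := by
  cases a with
  | none => rw [← app_bot (f := f), ← app_bot (f := g), h ⊥ (bdd_bot _)]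
  | some a =>
    have hz : Bdd (n + 1) (single a {n}) := bdd_single a (by simp)
    rw [← app_single_fresh hf, ← app_single_fresh hg, h _ hz]

theorem full_isStableModel : full.IsStableModel eps where
  isCombAlgebra := full_isCombAlgebra
  app_app f g := Subtype.ext (rewrite_arrowRule_app_app f.1 g.1)
  weakExt := by
    rintro ⟨f, n, hf⟩ ⟨g, k, hg⟩ h
    ext t s
    refine rewrite_arrowRule_app.trans (.trans (and_congr_right ?_) rewrite_arrowRule_app.symm)
    rintro ⟨a, b, -, rfl⟩
    exact apply_arr_iff_of_app_eq (hf.mono (le_max_left n k)) (hg.mono (le_max_right n k))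
      (fun z hz => congrArg Subtype.val (h ⟨z, _, hz⟩)) a
  fixed c := full_fixedUpTo_of_isArrow fun t s ⟨_, a, b, hρ, ht⟩ => ht ▸ hρ.isArrow

theorem bounded_isLambdaAlgebra (n : ℕ) : (bounded n).IsLambdaAlgebra :=
  CombStr.isLambdaAlgebra_of_embedding (i := Subtype.map id fun _ hf => ⟨n, hf⟩) full_isStableModel
    (Subtype.map_injective _ Function.injective_id) (fun _ _ => rfl) fun _ => rfl

section Representative

variable {ε : GSet} (hε : ∀ f g, Bdd n f → Bdd n g → (ε.app f).app g = f.app g)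
include hε

theorem app_single_arr_some (a b : Token) :
    ε.app (single (arr (some a) b) 0) (arr (some a) b) 0 := by
  have hbdd (t : Token) : Bdd n (single t 0) := bdd_single t (by simp)
  have h : (ε.app (single (arr (some a) b) 0)).app (single a 0) b 0 := by
    rw [hε _ _ (hbdd _) (hbdd _)]
    exact app_single.mpr (.inr ⟨0, ⟨rfl, rfl⟩, rfl⟩)
  obtain h | ⟨s, h, hs⟩ := app_single.mp h
  · rw [← app_bot (f := ε.app _), hε _ _ (hbdd _) (bdd_bot n), app_bot] at h
    cases h.1
  · obtain rfl : s = 0 := (add_zero s).symm.trans hs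
    exact h

theorem not_app_single_arr_none (hn : 0 < n) (a b : Token) :
    ¬ ε.app (single (arr none b) 0) (arr (some a) b) 0 := by
  intro h
  have happ : (ε.app (single (arr none b) 0)).app (single a {0}) b {0} :=
    app_single.mpr (.inr ⟨0, h, rfl⟩)
  rw [hε _ _ (bdd_single _ (by simp)) (bdd_single _ (by simpa using hn)), app_single] at happ
  simp [single] at happ

end Representative

theorem bounded_not_isCombinatoryModel (hn : 0 < n) : ¬ (bounded n).IsCombinatoryModel := by
  rintro ⟨-, ⟨ε, _⟩, happ, hext⟩
  have hε (f g : GSet) (hf : Bdd n f) (hg : Bdd n g) : (ε.app f).app g = f.app g :=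
    congrArg Subtype.val (happ ⟨f, hf⟩ ⟨g, hg⟩)
  let t : Token := arr (some atom) atom
  -- As the grades of `arr none atom` in `x` are all those allowed, adding `t` to `x` does not
  -- change how `x` acts.
  let x : GSet := fun a s => a = arr none atom ∧ ∀ i ∈ s, i < n
  have hx : Bdd n x := fun _ _ h => h.2
  have hx' : Bdd n (x ⊔ single t 0) := hx.sup (bdd_single t (by simp))
  have heq : ε.app x = ε.app (x ⊔ single t 0) := by
    refine congrArg Subtype.val (hext ⟨x, hx⟩ ⟨x ⊔ single t 0, hx'⟩ fun z => Subtype.ext ?_)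
    refine le_antisymm (app_mono le_sup_left le_rfl) ?_
    rintro b s ⟨a, s₁, s₂, h | ⟨ht, rfl⟩, hz, rfl⟩
    · exact ⟨a, s₁, s₂, h, hz, rfl⟩
    · obtain ⟨rfl, rfl⟩ := Token.arr.inj ht
      exact ⟨none, s₂, 0, ⟨rfl, z.2 _ _ hz⟩, rfl, add_comm _ _⟩
  have ht : ε.app x t 0 := heq ▸ app_mono le_rfl le_sup_right _ _ (app_single_arr_some hε _ _)
  exact not_app_single_arr_none hε hn _ _ (app_zero_mono (fun a h => ⟨h.1, rfl⟩) ht)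

end GSet

end StrictLambda

theorem mainTheorem11 :
    (StrictLambda.PInv.alg.IsLambdaAlgebra ∧ ¬ StrictLambda.PInv.alg.IsCombinatoryModel) ∧
      ∃ (A : Type) (S : StrictLambda.CombStr StrictLambda.Mode.affine A),
        S.IsLambdaAlgebra ∧ ¬ S.IsCombinatoryModel :=
  ⟨⟨StrictLambda.PInv.alg_isLambdaAlgebra, StrictLambda.PInv.alg_not_isCombinatoryModel⟩,
    _, StrictLambda.GSet.bounded 1, StrictLambda.GSet.bounded_isLambdaAlgebra 1,
    StrictLambda.GSet.bounded_not_isCombinatoryModel one_pos⟩
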